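/- Let $\lambda_1,\lambda_2,\lambda_3,\lambda_4,\lambda_S,\lambda_{S1},\lambda_{S2}\in\mathbb R$, $\lambda_{S12}\in\mathbb C$ and $\rho\in[0,1]$. For $h_1,h_2\in\mathbb R$ put $$M(h_1,h_2)=\lambda_{S1}h_1^2+\lambda_{S2}h_2^2-|\lambda_{S12}|\rho h_1h_2,$$ $$\widetilde V(h_1,h_2)=\lambda_1h_1^4+\lambda_2h_2^4+\lambda_3h_1^2h_2^2+\lambda_4\rho^2h_1^2h_2^2,$$ and put $$\lambda'_{40}=4\lambda_S\lambda_1-\lambda_{S1}^2,\quad \lambda'_{04}=4\lambda_S\lambda_2-\lambda_{S2}^2,\quad \lambda'_{13}=2\lambda_{S2}|\lambda_{S12}|\rho,\quad \lambda'_{31}=2\lambda_{S1}|\lambda_{S12}|\rho,$$ $$\lambda'_{22}=4\lambda_S\lambda_3+4\lambda_S\lambda_4\rho^2-|\lambda_{S12}|^2\rho^2-2\lambda_{S1}\lambda_{S2},$$ $$\Delta'=4\left(12\lambda'_{40}\lambda'_{04}-3\lambda'_{31}\lambda'_{13}+\lambda_{22}'^{2}\right)^3-\left(72\lambda'_{40}\lambda'_{22}\lambda'_{04}+9\lambda'_{31}\lambda'_{22}\lambda'_{13}-2\lambda_{22}'^{3}-27\lambda'_{40}\lambda_{13}'^{2}-27\lambda_{31}'^{2}\lambda'_{04}\right)^2.$$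 Assume that $\lambda'_{40}\neq0$ and $\lambda'_{04}\neq0$. Then $4\lambda_S\widetilde V(h_1,h_2)-M(h_1,h_2)^2\ge0$ for all $h_1\ge0$, $h_2\ge0$ if and only if $\lambda'_{40}>0$, $\lambda'_{04}>0$ and at least one of the following three conditions holds: (1) $\Delta'\le0$ and $\lambda'_{13}\sqrt{\lambda'_{40}}+\lambda'_{31}\sqrt{\lambda'_{04}}>0$; (2) $\lambda'_{13}\ge0$, $\lambda'_{31}\ge0$ and $\lambda'_{22}+2\sqrt{\lambda'_{40}\lambda'_{04}}\ge0$; (3) $\Delta'\ge0$, $\left|\lambda'_{31}\sqrt{\lambda'_{04}}-\lambda'_{13}\sqrt{\lambda'_{40}}\right|\le4\sqrt{\lambda'_{40}\lambda'_{22}\lambda'_{04}+2\lambda'_{40}\lambda'_{04}\sqrt{\lambda'_{40}\lambda'_{04}}}$, and either (i) $-2\sqrt{\lambda'_{40}\lambda'_{04}}\le\lambda'_{22}\le6\sqrt{\lambda'_{40}\lambda'_{04}}$, or (ii) $\lambda'_{22}>6\sqrt{\lambda'_{40}\lambda'_{04}}$ and $\lambda'_{31}\sqrt{\lambda'_{04}}+\lambda'_{13}\sqrt{\lambda'_{40}}\ge-4\sqrt{\lambda'_{40}\lambda'_{22}\lambda'_{04}-2\lambda'_{40}\lambda'_{04}\sqrt{\lambda'_{40}\lambda'_{04}}}$.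 -/

import Mathlib

/-- The couplings of the scalar potential
`V(h₁,h₂,s) = lamS s⁴ + M(h₁,h₂) s² + Ṽ(h₁,h₂)`, with the orbit space parameter `rho`. -/
structure Couplings where
  lam1 : ℝ
  lam2 : ℝ
  lam3 : ℝ
  lam4 : ℝ
  lamS : ℝ
  lamS1 : ℝ
  lamS2 : ℝ
  /-- the only coupling that may be complex; only its modulus enters the potential -/
  lamS12 : ℂ
  rho : ℝ

namespace Couplings

noncomputable section

/-- `M(h₁,h₂) = λ_{S1} h₁² + λ_{S2} h₂² - |λ_{S12}| ρ h₁ h₂`. -/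
def M (c : Couplings) (h₁ h₂ : ℝ) : ℝ :=
  c.lamS1 * h₁ ^ 2 + c.lamS2 * h₂ ^ 2 - ‖c.lamS12‖ * c.rho * h₁ * h₂

/-- `Ṽ(h₁,h₂) = λ₁ h₁⁴ + λ₂ h₂⁴ + λ₃ h₁² h₂² + λ₄ ρ² h₁² h₂²`. -/
def Vtilde (c : Couplings) (h₁ h₂ : ℝ) : ℝ :=
  c.lam1 * h₁ ^ 4 + c.lam2 * h₂ ^ 4 + c.lam3 * h₁ ^ 2 * h₂ ^ 2
    + c.lam4 * c.rho ^ 2 * h₁ ^ 2 * h₂ ^ 2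

/-- `λ'₄₀` -/
def l40 (c : Couplings) : ℝ := 4 * c.lamS * c.lam1 - c.lamS1 ^ 2

/-- `λ'₀₄` -/
def l04 (c : Couplings) : ℝ := 4 * c.lamS * c.lam2 - c.lamS2 ^ 2

/-- `λ'₁₃` -/
def l13 (c : Couplings) : ℝ := 2 * c.lamS2 * ‖c.lamS12‖ * c.rho

/-- `λ'₃₁` -/
def l31 (c : Couplings) : ℝ := 2 * c.lamS1 * ‖c.lamS12‖ * c.rho

/-- `λ'₂₂` -/
def l22 (c : Couplings) : ℝ :=
  4 * c.lamS * c.lam3 + 4 * c.lamS * c.lam4 * c.rho ^ 2 - ‖c.lamS12‖ ^ 2 * c.rho ^ 2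
    - 2 * c.lamS1 * c.lamS2

/-- `Δ'`, which is 27 times the discriminant of the quartic with coefficients
`λ'₀₄, λ'₁₃, λ'₂₂, λ'₃₁, λ'₄₀`. -/
def Disc (c : Couplings) : ℝ :=
  4 * (12 * c.l40 * c.l04 - 3 * c.l31 * c.l13 + c.l22 ^ 2) ^ 3
    - (72 * c.l40 * c.l22 * c.l04 + 9 * c.l31 * c.l22 * c.l13 - 2 * c.l22 ^ 3
        - 27 * c.l40 * c.l13 ^ 2 - 27 * c.l31 ^ 2 * c.l04) ^ 2

end

end Couplings

/-! The form is a binary quartic whose end coefficients must be positive, so rescaling makes it `x⁴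
+ A x³ + B x² + C x + 1`. This splits as `(x² + k s x + k²)(x² + l t x + l²)` with `k l = 1`. Each
factor is nonnegative on `[0, ∞)` exactly when its parameter `s` or `t` is at least `-2`; otherwise
it has two positive roots, at which the other factor must change sign too, so the factors coincide
(`mul_quadratics_nonneg_iff`). It remains to read this off `A, B, C`: by `normalizedDisc_eq` the
discriminant has the sign of `(s² - 4)(t² - 4)` wherever the resultant is nonzero, and `A + C`, `A -
C`, `B` locate `s` and `t` relative to `±2`. -/

/-! ### Factorization into quadratics -/

/-- Every real monic quartic with constant term `1` splits into two real quadratics with positive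
constant terms. -/
theorem exists_quadratic_factors (A B C : ℝ) :
    ∃ k l s t : ℝ, 0 < k ∧ 0 < l ∧ k * l = 1 ∧ A = k * s + l * t ∧
      B = k ^ 2 + l ^ 2 + s * t ∧ C = l * s + k * t := by
  -- Unknowns `w = k + l`, `d = k - l`, `σ = s + t`, `δ = s - t` decouple the system.
  have key : ∀ w d σ δ : ℝ, 2 ≤ w → 0 ≤ d → w ^ 2 - d ^ 2 = 4 → A + C = w * σ → A - C = d * δ →
      4 * (B + 2 - w ^ 2) = σ ^ 2 - δ ^ 2 →
      ∃ k l s t : ℝ, 0 < k ∧ 0 < l ∧ k * l = 1 ∧ A = k * s + l * t ∧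
        B = k ^ 2 + l ^ 2 + s * t ∧ C = l * s + k * t := by
    intro w d σ δ hw hd hwd h1 h2 h3
    refine ⟨(w + d) / 2, (w - d) / 2, (σ + δ) / 2, (σ - δ) / 2, by linarith, by nlinarith,
      by linarith, by linarith, by linarith, by linarith⟩
  -- `z = w ^ 2` is a root of the resolvent cubic beyond `4`
  have key2 : ∀ z : ℝ, 4 < z →
      (A + C) ^ 2 * (z - 4) - (A - C) ^ 2 * z - 4 * (B + 2 - z) * z * (z - 4) = 0 →
      ∃ k l s t : ℝ, 0 < k ∧ 0 < l ∧ k * l = 1 ∧ A = k * s + l * t ∧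
        B = k ^ 2 + l ^ 2 + s * t ∧ C = l * s + k * t := by
    intro z hz hg
    have hz0 : z ≠ 0 := by linarith
    have hz4 : z - 4 ≠ 0 := by linarith
    have hw : √z ^ 2 = z := Real.sq_sqrt (by linarith)
    have hd : √(z - 4) ^ 2 = z - 4 := Real.sq_sqrt (by linarith)
    have hw0 : √z ≠ 0 := (Real.sqrt_pos.2 (by linarith)).ne'
    have hd0 : √(z - 4) ≠ 0 := (Real.sqrt_pos.2 (by linarith)).ne'
    refine key (√z) (√(z - 4)) ((A + C) / √z) ((A - C) / √(z - 4))
      (Real.le_sqrt_of_sq_le (by linarith)) (Real.sqrt_nonneg _) (by linarith)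
      (by field_simp) (by field_simp) ?_
    rw [div_pow, div_pow, hw, hd]
    field_simp
    linarith
  have large : ∃ b : ℝ, 4 ≤ b ∧ |A| + |B| + |C| + 10 ≤ b ∧ 4 * (A - C) ^ 2 + 10 ≤ b :=
    ⟨|A| + |B| + |C| + 10 + 4 * (A - C) ^ 2,
      by linarith [abs_nonneg A, abs_nonneg B, abs_nonneg C, sq_nonneg (A - C)],
      by nlinarith [sq_nonneg (A - C)],
      by linarith [abs_nonneg A, abs_nonneg B, abs_nonneg C]⟩
  obtain ⟨b, hb4, hb, hb'⟩ := large
  have hB := le_abs_self B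
  have hA0 := abs_nonneg A
  have hC0 := abs_nonneg C
  -- When `A = C` the resolvent has the spurious root `4`, so `z - 4` is divided out; otherwise its
  -- value at `4` is already negative.
  by_cases hAC : A = C
  · subst hAC
    by_cases hq : 4 * (B - 2) ≤ A ^ 2
    · refine key 2 0 A √(A ^ 2 - 4 * (B - 2)) le_rfl le_rfl (by norm_num) (by ring) (by ring) ?_
      rw [Real.sq_sqrt (by linarith)]
      ring
    · push Not at hq
      obtain ⟨z, hz, hz0⟩ := intermediate_value_Icc (f := fun z : ℝ => z ^ 2 - (B + 2) * z + A ^ 2)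
        hb4 (by fun_prop) (show (0 : ℝ) ∈ _ from ⟨by nlinarith, by nlinarith [sq_nonneg A]⟩)
      simp only at hz0
      have : z ≠ 4 := by rintro rfl; nlinarith
      exact key2 z (lt_of_le_of_ne hz.1 this.symm) (by linear_combination 4 * (z - 4) * hz0)
  · have hpos : 0 < (A - C) ^ 2 := by
      have : A - C ≠ 0 := sub_ne_zero.2 hAC
      positivity
    obtain ⟨z, hz, hz0⟩ := intermediate_value_Icc (f := fun z : ℝ =>
        (A + C) ^ 2 * (z - 4) - (A - C) ^ 2 * z - 4 * (B + 2 - z) * z * (z - 4))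
      hb4 (by fun_prop) (show (0 : ℝ) ∈ _ from ⟨by nlinarith, by
        have h1 : 0 ≤ (A + C) ^ 2 * (b - 4) := mul_nonneg (sq_nonneg _) (by linarith)
        have h2 : 1 ≤ (b - B - 2) * (b - 4) := by nlinarith
        have h3 : (A - C) ^ 2 * b ≤ b * b := by nlinarith
        have h4 : b ≤ (b - B - 2) * (b - 4) * 4 := by nlinarith
        nlinarith⟩)
    simp only at hz0
    have : z ≠ 4 := by rintro rfl; nlinarith
    exact key2 z (lt_of_le_of_ne hz.1 this.symm) hz0

/-! ### Sign of a product of two quadratics -/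

/-- If the product of two quadratics with positive constant terms is nonnegative on `[0, ∞)` and the
first has two distinct positive roots, then the quadratics coincide. -/
theorem quadratics_eq_of_mul_nonneg {k l s t : ℝ} (hk : 0 < k) (hl : 0 < l)
    (h : ∀ x : ℝ, 0 ≤ x → 0 ≤ (x ^ 2 + k * s * x + k ^ 2) * (x ^ 2 + l * t * x + l ^ 2))
    (hs : s < -2) : k = l ∧ s = t := by
  obtain ⟨q, hq, hq2⟩ : ∃ q : ℝ, 0 < q ∧ q ^ 2 = s ^ 2 - 4 :=
    ⟨√(s ^ 2 - 4), Real.sqrt_pos.2 (by nlinarith), Real.sq_sqrt (by nlinarith)⟩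
  have hqs : q < -s := by nlinarith
  set r₁ := k * (-s - q) / 2 with hr₁
  set r₂ := k * (-s + q) / 2 with hr₂
  have h1 : 0 < r₁ := by rw [hr₁]; have := mul_pos hk (by linarith : 0 < -s - q); linarith
  have h12 : r₁ < r₂ := by rw [hr₁, hr₂]; nlinarith
  have hsum : r₁ + r₂ = -(k * s) := by rw [hr₁, hr₂]; ring
  have hprod : r₁ * r₂ = k ^ 2 := by
    rw [hr₁, hr₂]; linear_combination (-k ^ 2 / 4) * hq2
  have hfac : ∀ x : ℝ, x ^ 2 + k * s * x + k ^ 2 = (x - r₁) * (x - r₂) := fun x => by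
    linear_combination -x * hsum - hprod
  -- The sign of the second factor is forced on each open interval cut out by `r₁, r₂`; closures
  -- carry it to the endpoints, where the factor must vanish.
  have hin : ∀ x ∈ Set.Icc r₁ r₂, x ^ 2 + l * t * x + l ^ 2 ≤ 0 := by
    rw [← closure_Ioo h12.ne]
    intro x hx
    refine closure_minimal (t := {x : ℝ | x ^ 2 + l * t * x + l ^ 2 ≤ 0}) ?_
      (isClosed_le (by fun_prop) (by fun_prop)) hx
    intro y hy
    have hp := h y (by linarith [hy.1])
    rw [hfac] at hp
    have : (y - r₁) * (y - r₂) < 0 := mul_neg_of_pos_of_neg (by linarith [hy.1]) (by linarith [hy.2])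
    exact nonpos_of_mul_nonneg_right hp this
  have hright : ∀ x ∈ Set.Ici r₂, 0 ≤ x ^ 2 + l * t * x + l ^ 2 := by
    rw [← closure_Ioi]
    intro x hx
    refine closure_minimal (t := {x : ℝ | 0 ≤ x ^ 2 + l * t * x + l ^ 2}) ?_
      (isClosed_le (by fun_prop) (by fun_prop)) hx
    intro y (hy : r₂ < y)
    have hp := h y (by linarith)
    rw [hfac] at hp
    exact nonneg_of_mul_nonneg_right hp (mul_pos (by linarith) (by linarith))
  have hleft : ∀ x ∈ Set.Icc 0 r₁, 0 ≤ x ^ 2 + l * t * x + l ^ 2 := by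
    rw [← closure_Ioo h1.ne]
    intro x hx
    refine closure_minimal (t := {x : ℝ | 0 ≤ x ^ 2 + l * t * x + l ^ 2}) ?_
      (isClosed_le (by fun_prop) (by fun_prop)) hx
    intro y hy
    have hp := h y hy.1.le
    rw [hfac] at hp
    exact nonneg_of_mul_nonneg_right hp
      (mul_pos_of_neg_of_neg (by linarith [hy.2]) (by linarith [hy.2]))
  have e1 : r₁ ^ 2 + l * t * r₁ + l ^ 2 = 0 :=
    le_antisymm (hin r₁ ⟨le_rfl, h12.le⟩) (hleft r₁ ⟨h1.le, le_rfl⟩)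
  have e2 : r₂ ^ 2 + l * t * r₂ + l ^ 2 = 0 :=
    le_antisymm (hin r₂ ⟨h12.le, le_rfl⟩) (hright r₂ Set.self_mem_Ici)
  have e3 : l * t = k * s := by
    have : (r₂ - r₁) * (r₂ + r₁ + l * t) = 0 := by linear_combination e2 - e1
    rcases mul_eq_zero.1 this with h' | h' <;> linarith
  have e4 : l ^ 2 = k ^ 2 := by
    rw [e3] at e1
    linear_combination e1 - hfac r₁
  have e5 : l = k := (sq_eq_sq₀ hl.le hk.le).1 e4
  subst e5
  exact ⟨rfl, (mul_left_cancel₀ hl.ne' e3).symm⟩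

theorem mul_quadratics_nonneg_iff {k l s t : ℝ} (hk : 0 < k) (hl : 0 < l) :
    (∀ x : ℝ, 0 ≤ x → 0 ≤ (x ^ 2 + k * s * x + k ^ 2) * (x ^ 2 + l * t * x + l ^ 2)) ↔
      (-2 ≤ s ∧ -2 ≤ t) ∨ (k = l ∧ s = t) := by
  constructor
  · intro h
    by_cases hs : s < -2
    · exact Or.inr (quadratics_eq_of_mul_nonneg hk hl h hs)
    · by_cases ht : t < -2
      · obtain ⟨h1, h2⟩ := quadratics_eq_of_mul_nonneg hl hk
          (fun x hx => by rw [mul_comm]; exact h x hx) ht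
        exact Or.inr ⟨h1.symm, h2.symm⟩
      · exact Or.inl ⟨not_lt.1 hs, not_lt.1 ht⟩
  · rintro (⟨hs, ht⟩ | ⟨rfl, rfl⟩) x hx
    · have : ∀ k s : ℝ, 0 < k → -2 ≤ s → 0 ≤ x ^ 2 + k * s * x + k ^ 2 := fun k s hk hs => by
        nlinarith [sq_nonneg (x - k), mul_nonneg (mul_nonneg hk.le hx) (by linarith : 0 ≤ s + 2)]
      exact mul_nonneg (this k s hk hs) (this l t hl ht)
    · exact mul_self_nonneg _

/-! ### Discriminant and the normalized criterion -/

/-- The resultant of `x² + k s x + k²` and `x² + l t x + l²` for `k l = 1` and `z = (k + l)²`. -/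
noncomputable def pairResultant (z s t : ℝ) : ℝ := (z - 4) * (z - s * t) + (s - t) ^ 2

/-- 27 times the discriminant of `x⁴ + A x³ + B x² + C x + 1`. -/
noncomputable def normalizedDisc (A B C : ℝ) : ℝ :=
  4 * (12 - 3 * A * C + B ^ 2) ^ 3
    - (72 * B + 9 * A * B * C - 2 * B ^ 3 - 27 * C ^ 2 - 27 * A ^ 2) ^ 2

theorem normalizedDisc_eq {k l s t A B C : ℝ} (hkl : k * l = 1) (hA : A = k * s + l * t)
    (hB : B = k ^ 2 + l ^ 2 + s * t) (hC : C = l * s + k * t) :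
    normalizedDisc A B C =
      27 * ((s ^ 2 - 4) * (t ^ 2 - 4) * pairResultant ((k + l) ^ 2) s t ^ 2) := by
  set z := (k + l) ^ 2 with hz
  have hB' : B = z - 2 + s * t := by rw [hB, hz]; linear_combination (-2) * hkl
  have hAC : A * C = s ^ 2 + t ^ 2 + (z - 2) * (s * t) := by
    rw [hA, hC, hz]; linear_combination (s ^ 2 + t ^ 2 - 2 * s * t) * hkl
  have hAA : A ^ 2 + C ^ 2 = (z - 2) * (s ^ 2 + t ^ 2) + 4 * s * t := by
    rw [hA, hC, hz]; linear_combination (4 * s * t - 2 * s ^ 2 - 2 * t ^ 2) * hkl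
  have : normalizedDisc A B C = 4 * (12 - 3 * (A * C) + B ^ 2) ^ 3
    - (72 * B + 9 * B * (A * C) - 2 * B ^ 3 - 27 * (A ^ 2 + C ^ 2)) ^ 2 := by
    unfold normalizedDisc; ring
  rw [this, hAC, hAA, hB', pairResultant]
  ring

theorem pairResultant_pos_of_lt {z s t : ℝ} (h : (s ^ 2 - 4) * (t ^ 2 - 4) < 0) :
    0 < pairResultant z s t := by
  unfold pairResultant
  -- As a quadratic in `z`, the resultant has discriminant `(s² - 4)(t² - 4)`.
  nlinarith [sq_nonneg (2 * z - (4 + s * t))]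

/-- The case distinction for the monic quartic with constant term `1`. -/
def NormalizedCriterion (A B C : ℝ) : Prop :=
  (normalizedDisc A B C ≤ 0 ∧ 0 < A + C) ∨
    (0 ≤ C ∧ 0 ≤ A ∧ 0 ≤ B + 2) ∨
    (0 ≤ normalizedDisc A B C ∧ |A - C| ≤ 4 * √(B + 2) ∧
      ((-2 ≤ B ∧ B ≤ 6) ∨ (6 < B ∧ -4 * √(B - 2) ≤ A + C)))

/-- The position of `s, t` relative to `2` selects the alternative: both at least `2` gives the
second, one on each side with `s + t > 0` the first, both at most `2` the third. -/
theorem normalizedCriterion_of_ge_neg_two {k l s t A B C : ℝ} (hk : 0 < k) (hl : 0 < l)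
    (hkl : k * l = 1) (hA : A = k * s + l * t) (hB : B = k ^ 2 + l ^ 2 + s * t)
    (hC : C = l * s + k * t) (hs : -2 ≤ s) (ht : -2 ≤ t) : NormalizedCriterion A B C := by
  have hD := normalizedDisc_eq hkl hA hB hC
  have hsum : A + C = (k + l) * (s + t) := by rw [hA, hC]; ring
  have hdiff : (A - C) ^ 2 = ((k + l) ^ 2 - 4) * (s - t) ^ 2 := by
    rw [hA, hC]; linear_combination (-4 * (s - t) ^ 2) * hkl
  have hB' : B = (k + l) ^ 2 - 2 + s * t := by rw [hB]; linear_combination (-2) * hkl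
  have hz : 4 ≤ (k + l) ^ 2 := by nlinarith [sq_nonneg (k - l)]
  by_cases hbig : 2 ≤ s ∧ 2 ≤ t
  · obtain ⟨hs2, ht2⟩ := hbig
    refine Or.inr (Or.inl ⟨?_, ?_, by nlinarith⟩)
    · rw [hC]; positivity
    · rw [hA]; positivity
  by_cases hmix : 0 < s + t ∧ (2 ≤ s ∨ 2 ≤ t)
  · refine Or.inl ⟨?_, ?_⟩
    · have : (s ^ 2 - 4) * (t ^ 2 - 4) ≤ 0 := by
        rcases hmix.2 with h | h
        · have : t < 2 := not_le.1 fun h' => hbig ⟨h, h'⟩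
          exact mul_nonpos_of_nonneg_of_nonpos (by nlinarith) (by nlinarith)
        · have : s < 2 := not_le.1 fun h' => hbig ⟨h', h⟩
          exact mul_nonpos_of_nonpos_of_nonneg (by nlinarith) (by nlinarith)
      rw [hD]
      have := mul_nonpos_of_nonpos_of_nonneg this (sq_nonneg (pairResultant ((k + l) ^ 2) s t))
      linarith
    · rw [hsum]; exact mul_pos (by linarith) hmix.1
  have hs2 : s ≤ 2 := by
    by_contra! h
    exact hmix ⟨by linarith, Or.inl h.le⟩
  have ht2 : t ≤ 2 := by
    by_contra! h
    exact hmix ⟨by linarith, Or.inr h.le⟩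
  have hs4 : s ^ 2 ≤ 4 := by linarith [mul_nonneg (by linarith : 0 ≤ s + 2) (sub_nonneg.2 hs2)]
  have ht4 : t ^ 2 ≤ 4 := by linarith [mul_nonneg (by linarith : 0 ≤ t + 2) (sub_nonneg.2 ht2)]
  have hst : -4 ≤ s * t := by linarith [sq_nonneg (s + t)]
  have hσ : (s + t) ^ 2 ≤ 16 := by linarith [sq_nonneg (s - t)]
  have hδ : (s - t) ^ 2 ≤ 16 := by linarith [sq_nonneg (s + t)]
  refine Or.inr (Or.inr ⟨?_, ?_, ?_⟩)
  · rw [hD]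
    have : 0 ≤ (s ^ 2 - 4) * (t ^ 2 - 4) := mul_nonneg_of_nonpos_of_nonpos (by linarith) (by linarith)
    positivity
  · refine abs_le_of_sq_le_sq ?_ (by positivity)
    rw [mul_pow, Real.sq_sqrt (by linarith), hdiff, hB']
    have := mul_le_mul_of_nonneg_left hδ (by linarith : 0 ≤ (k + l) ^ 2 - 4)
    linarith
  · rcases le_or_gt B 6 with h6 | h6
    · exact Or.inl ⟨by linarith, h6⟩
    · refine Or.inr ⟨h6, ?_⟩
      rcases le_or_gt 0 (s + t) with h0 | h0
      · have : 0 ≤ A + C := by rw [hsum]; positivity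
        linarith [Real.sqrt_nonneg (B - 2)]
      · have hle : -(A + C) ≤ 4 * √(B - 2) := by
          refine abs_le_of_sq_le_sq' ?_ (by positivity) |>.2
          rw [mul_pow, Real.sq_sqrt (by linarith), neg_sq, hsum, hB', mul_pow]
          have hz' : 8 - s * t ≤ (k + l) ^ 2 := by linarith
          have hP : -2 * (s + t) - 4 ≤ s * t := by
            linarith [mul_nonneg (by linarith : 0 ≤ s + 2) (by linarith : 0 ≤ t + 2)]
          -- With `B > 6` bounding `(k + l)²` below and `(s + 2)(t + 2) ≥ 0` bounding `s t` below,
          -- the claim reduces to a cubic in `s + t` with double root `-4`.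
          have h1 : (8 - s * t) * (16 - (s + t) ^ 2) ≤ (k + l) ^ 2 * (16 - (s + t) ^ 2) :=
            mul_le_mul_of_nonneg_right hz' (by linarith)
          have h2 : (-2 * (s + t) - 4) * (s + t) ^ 2 ≤ s * t * (s + t) ^ 2 :=
            mul_le_mul_of_nonneg_right hP (sq_nonneg _)
          have h3 : 0 ≤ (s + t + 4) ^ 2 * (2 - (s + t)) :=
            mul_nonneg (sq_nonneg _) (by linarith)
          linarith
        linarith

/-- Here the quartic is `(x² + s x + 1)²`: the discriminant vanishes and the lower bound on `A + C`
is an equality. -/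
theorem normalizedCriterion_of_square {k l s t A B C : ℝ} (hk : 0 < k)
    (hkl : k * l = 1) (hA : A = k * s + l * t) (hB : B = k ^ 2 + l ^ 2 + s * t)
    (hC : C = l * s + k * t) (h1 : k = l) (h2 : s = t) (hs : s < -2) :
    NormalizedCriterion A B C := by
  have hD := normalizedDisc_eq hkl hA hB hC
  subst h1 h2
  obtain rfl : k = 1 := by nlinarith
  have hD0 : normalizedDisc A B C = 0 := by rw [hD, pairResultant]; ring
  refine Or.inr (Or.inr ⟨hD0.ge, ?_, Or.inr ⟨by nlinarith, ?_⟩⟩)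
  · rw [show A - C = 0 by rw [hA, hC]; ring, abs_zero]
    positivity
  · rw [show B - 2 = (-s) ^ 2 by rw [hB]; ring, Real.sqrt_sq (by linarith), hA, hC]
    linarith

/-- Given `s < -2`, the first alternative forces `t > 2` and a positive discriminant, a
contradiction. In the third, `|t| ≥ 2`; the bound on `A - C` excludes `t ≥ 2`, and for `t ≤ -2` the
bound on `A + C` is tight only for equal factors. -/
theorem pair_of_normalizedCriterion {k l s t A B C : ℝ} (hk : 0 < k) (hl : 0 < l)
    (hkl : k * l = 1) (hA : A = k * s + l * t) (hB : B = k ^ 2 + l ^ 2 + s * t)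
    (hC : C = l * s + k * t) (hs : s < -2)
    (h : (normalizedDisc A B C ≤ 0 ∧ 0 < A + C) ∨
      (0 ≤ normalizedDisc A B C ∧ |A - C| ≤ 4 * √(B + 2) ∧
      ((-2 ≤ B ∧ B ≤ 6) ∨ (6 < B ∧ -4 * √(B - 2) ≤ A + C)))) : k = l ∧ s = t := by
  have hD := normalizedDisc_eq hkl hA hB hC
  have hsum : A + C = (k + l) * (s + t) := by rw [hA, hC]; ring
  have hdiff : (A - C) ^ 2 = ((k + l) ^ 2 - 4) * (s - t) ^ 2 := by
    rw [hA, hC]; linear_combination (-4 * (s - t) ^ 2) * hkl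
  have hB' : B = (k + l) ^ 2 - 2 + s * t := by rw [hB]; linear_combination (-2) * hkl
  have hz : 4 ≤ (k + l) ^ 2 := by nlinarith [sq_nonneg (k - l)]
  have hs4 : 0 < s ^ 2 - 4 := by
    linarith [mul_pos (by linarith : 0 < -2 - s) (by linarith : 0 < 2 - s)]
  rcases h with ⟨hd, hpos⟩ | ⟨hd, hab, hcase⟩
  · exfalso
    have hst : 0 < s + t := by
      rw [hsum] at hpos
      exact pos_of_mul_pos_right hpos (by linarith)
    have ht4 : 0 < t ^ 2 - 4 := by
      linarith [mul_pos (by linarith : 0 < t - 2) (by linarith : 0 < t + 2)]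
    have hR : 0 < pairResultant ((k + l) ^ 2) s t := by
      unfold pairResultant
      have : 0 ≤ ((k + l) ^ 2 - 4) * ((k + l) ^ 2 - s * t) :=
        mul_nonneg (by linarith) (by nlinarith)
      have : 0 < (s - t) ^ 2 := by nlinarith
      linarith
    have : 0 < normalizedDisc A B C := by rw [hD]; positivity
    linarith
  · have ht4 : 0 ≤ t ^ 2 - 4 := by
      by_contra! hneg
      have hlt := mul_neg_of_pos_of_neg hs4 hneg
      have := mul_neg_of_neg_of_pos hlt (pow_pos (pairResultant_pos_of_lt (z := (k + l) ^ 2) hlt) 2)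
      linarith
    have hB2 : 0 ≤ B + 2 := by rcases hcase with h | h <;> linarith [h.1]
    rcases le_or_gt 0 t with ht0 | ht0
    · exfalso
      have ht2 : 2 ≤ t := by
        by_contra! hlt
        linarith [mul_pos (by linarith : 0 < 2 - t) (by linarith : 0 < t + 2)]
      have hsq : (A - C) ^ 2 ≤ 16 * (B + 2) := by
        have := pow_le_pow_left₀ (abs_nonneg _) hab 2
        rw [sq_abs, mul_pow, Real.sq_sqrt hB2] at this
        linarith
      rw [hdiff, hB'] at hsq
      have : 16 ≤ (s - t) ^ 2 := by linarith [sq_nonneg (t - s - 4)]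
      have : ((k + l) ^ 2 - 4) * 16 ≤ ((k + l) ^ 2 - 4) * (s - t) ^ 2 :=
        mul_le_mul_of_nonneg_left this (by linarith)
      linarith [mul_nonneg (by linarith : 0 ≤ t - 2) (by linarith : 0 ≤ -s)]
    · have ht2 : t ≤ -2 := by
        by_contra! hlt
        linarith [mul_pos (by linarith : 0 < 2 - t) (by linarith : 0 < t + 2)]
      have hst : 4 < s * t := by
        linarith [mul_nonneg (by linarith : 0 ≤ -2 - s) (by linarith : 0 ≤ -2 - t)]
      rcases hcase with h | ⟨h6, hle⟩
      · linarith [h.2]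
      · have hsq : (A + C) ^ 2 ≤ 16 * (B - 2) := by
          have hn : 0 ≤ -(A + C) := by
            have := mul_nonneg (by linarith : 0 ≤ k + l) (by linarith : 0 ≤ -(s + t))
            linarith
          have := pow_le_pow_left₀ hn (by linarith : -(A + C) ≤ 4 * √(B - 2)) 2
          rw [neg_sq, mul_pow, Real.sq_sqrt (by linarith)] at this
          linarith
        rw [hsum, mul_pow, hB'] at hsq
        have h16 : 0 < (s + t) ^ 2 - 16 := by linarith [sq_nonneg (s - t)]
        -- Both summands are nonnegative, so both vanish.
        have hsum0 : ((k + l) ^ 2 - 4) * ((s + t) ^ 2 - 16) + 4 * (s - t) ^ 2 ≤ 0 := by linarith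
        have hz0 : ((k + l) ^ 2 - 4) * ((s + t) ^ 2 - 16) = 0 :=
          le_antisymm (by linarith [sq_nonneg (s - t)]) (mul_nonneg (by linarith) h16.le)
        have hst0 : (s - t) ^ 2 = 0 := le_antisymm (by linarith) (sq_nonneg _)
        have hkl0 : (k - l) ^ 2 = 0 := by
          rcases mul_eq_zero.1 hz0 with h | h
          · linear_combination h - 4 * hkl
          · exact absurd h h16.ne'
        exact ⟨sub_eq_zero.1 (pow_eq_zero_iff two_ne_zero |>.1 hkl0),
          sub_eq_zero.1 (pow_eq_zero_iff two_ne_zero |>.1 hst0)⟩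

/-- A real quartic `x⁴ + A x³ + B x² + C x + 1` is nonnegative on `[0, ∞)` if and only if the
normalized criterion holds. -/
theorem normalized_quartic_nonneg_iff (A B C : ℝ) :
    (∀ x : ℝ, 0 ≤ x → 0 ≤ x ^ 4 + A * x ^ 3 + B * x ^ 2 + C * x + 1) ↔
      NormalizedCriterion A B C := by
  obtain ⟨k, l, s, t, hk, hl, hkl, hA, hB, hC⟩ := exists_quadratic_factors A B C
  have hfac : ∀ x : ℝ, x ^ 4 + A * x ^ 3 + B * x ^ 2 + C * x + 1 =
      (x ^ 2 + k * s * x + k ^ 2) * (x ^ 2 + l * t * x + l ^ 2) := fun x => by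
    rw [hA, hB, hC]
    linear_combination (-x ^ 2 * s * t - x * (l * s + k * t) - (k * l + 1)) * hkl
  have hiff := mul_quadratics_nonneg_iff (s := s) (t := t) hk hl
  constructor
  · intro h
    by_cases hge : -2 ≤ s ∧ -2 ≤ t
    · exact normalizedCriterion_of_ge_neg_two hk hl hkl hA hB hC hge.1 hge.2
    · rcases hiff.1 fun x hx => (hfac x) ▸ h x hx with h' | ⟨h1, h2⟩
      · exact absurd h' hge
      · exact normalizedCriterion_of_square hk hkl hA hB hC h1 h2
          (not_le.1 fun hs => hge ⟨hs, h2 ▸ hs⟩)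
  · rintro h
    -- The second alternative needs no factorization: it gives nonnegativity term by term.
    have main : (0 ≤ C ∧ 0 ≤ A ∧ 0 ≤ B + 2) ∨ ((-2 ≤ s ∧ -2 ≤ t) ∨ (k = l ∧ s = t)) := by
      rw [NormalizedCriterion, or_left_comm] at h
      refine h.imp_right fun h => ?_
      by_cases hs : s < -2
      · exact Or.inr (pair_of_normalizedCriterion hk hl hkl hA hB hC hs h)
      · by_cases ht : t < -2
        · obtain ⟨h1, h2⟩ := pair_of_normalizedCriterion (s := t) (t := s) hl hk (by linarith)
            (by linarith) (by linarith) (by linarith) ht h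
          exact Or.inr ⟨h1.symm, h2.symm⟩
        · exact Or.inl ⟨not_lt.1 hs, not_lt.1 ht⟩
    rcases main with ⟨hC0, hA0, hB0⟩ | h'
    · intro x hx
      have : x ^ 4 + A * x ^ 3 + B * x ^ 2 + C * x + 1 =
        (x ^ 2 - 1) ^ 2 + A * x ^ 3 + (B + 2) * x ^ 2 + C * x := by ring
      rw [this]
      positivity
    · intro x hx
      rw [hfac]
      exact hiff.2 h' x hx

/-! ### Rescaling and the potential -/

/-- Nonnegativity on the closed quadrant of a binary quartic form with leading coefficients
`α ^ 4` and `β ^ 4`. -/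
theorem binary_quartic_nonneg_iff {α β : ℝ} (hα : 0 < α) (hβ : 0 < β) (A B C : ℝ) :
    (∀ x y : ℝ, 0 ≤ x → 0 ≤ y → 0 ≤ α ^ 4 * x ^ 4 + α ^ 3 * β * A * x ^ 3 * y
      + α ^ 2 * β ^ 2 * B * x ^ 2 * y ^ 2 + α * β ^ 3 * C * x * y ^ 3 + β ^ 4 * y ^ 4) ↔
      NormalizedCriterion A B C := by
  rw [← normalized_quartic_nonneg_iff]
  constructor
  · intro h x hx
    refine (h (x / α) (1 / β) (by positivity) (by positivity)).trans_eq ?_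
    field_simp
  · intro h x y hx hy
    rcases hy.eq_or_lt with rfl | hy
    · have : 0 ≤ α ^ 4 * x ^ 4 := by positivity
      simpa using this
    · refine (mul_nonneg (h (α * x / (β * y)) (by positivity))
        (pow_pos (mul_pos hβ hy) 4).le).trans_eq ?_
      field_simp

theorem mul_nonpos_iff_of_pos_left {a b : ℝ} (ha : 0 < a) : a * b ≤ 0 ↔ b ≤ 0 := by
  rw [← not_lt, mul_pos_iff_of_pos_left ha, not_lt]

theorem exists_pow_four_eq {a : ℝ} (ha : 0 < a) : ∃ α : ℝ, 0 < α ∧ a = α ^ 4 := by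
  refine ⟨√√a, by positivity, ?_⟩
  rw [show (4 : ℕ) = 2 * 2 from rfl, pow_mul, Real.sq_sqrt (by positivity), Real.sq_sqrt ha.le]

theorem binary_quartic_nonneg_iff_criterion {a b c d e : ℝ} (ha : 0 < a) (he : 0 < e) :
    (∀ x y : ℝ, 0 ≤ x → 0 ≤ y →
      0 ≤ a * x ^ 4 + b * x ^ 3 * y + c * x ^ 2 * y ^ 2 + d * x * y ^ 3 + e * y ^ 4) ↔
      ((4 * (12 * a * e - 3 * b * d + c ^ 2) ^ 3
        - (72 * a * c * e + 9 * b * c * d - 2 * c ^ 3 - 27 * a * d ^ 2 - 27 * b ^ 2 * e) ^ 2 ≤ 0 ∧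
          0 < d * √a + b * √e) ∨
        (0 ≤ d ∧ 0 ≤ b ∧ 0 ≤ c + 2 * √(a * e)) ∨
        (0 ≤ 4 * (12 * a * e - 3 * b * d + c ^ 2) ^ 3
        - (72 * a * c * e + 9 * b * c * d - 2 * c ^ 3 - 27 * a * d ^ 2 - 27 * b ^ 2 * e) ^ 2 ∧
          |b * √e - d * √a| ≤ 4 * √(a * c * e + 2 * a * e * √(a * e)) ∧
          ((-2 * √(a * e) ≤ c ∧ c ≤ 6 * √(a * e)) ∨
            (6 * √(a * e) < c ∧
              -4 * √(a * c * e - 2 * a * e * √(a * e)) ≤ b * √e + d * √a)))) := by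
  -- Fourth roots turn the square roots of `a`, `e` and `a * e` into monomials, so each condition is
  -- its normalized version times a positive monomial.
  obtain ⟨α, hα, rfl⟩ := exists_pow_four_eq ha
  obtain ⟨β, hβ, rfl⟩ := exists_pow_four_eq he
  obtain ⟨A, rfl⟩ : ∃ A, b = α ^ 3 * β * A := ⟨b / (α ^ 3 * β), by field_simp⟩
  obtain ⟨B, rfl⟩ : ∃ B, c = α ^ 2 * β ^ 2 * B := ⟨c / (α ^ 2 * β ^ 2), by field_simp⟩
  obtain ⟨C, rfl⟩ : ∃ C, d = α * β ^ 3 * C := ⟨d / (α * β ^ 3), by field_simp⟩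
  have hsα : √(α ^ 4) = α ^ 2 := by
    rw [show α ^ 4 = (α ^ 2) ^ 2 by ring, Real.sqrt_sq (by positivity)]
  have hsβ : √(β ^ 4) = β ^ 2 := by
    rw [show β ^ 4 = (β ^ 2) ^ 2 by ring, Real.sqrt_sq (by positivity)]
  have hsαβ : √(α ^ 4 * β ^ 4) = α ^ 2 * β ^ 2 := by
    rw [Real.sqrt_mul (by positivity), hsα, hsβ]
  have hsq : ∀ u : ℝ, √((α ^ 3 * β ^ 3) ^ 2 * u) = α ^ 3 * β ^ 3 * √u := fun u => by
    rw [Real.sqrt_mul (by positivity), Real.sqrt_sq (by positivity)]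
  have hdisc : 4 * (12 * α ^ 4 * β ^ 4 - 3 * (α ^ 3 * β * A) * (α * β ^ 3 * C)
        + (α ^ 2 * β ^ 2 * B) ^ 2) ^ 3
      - (72 * α ^ 4 * (α ^ 2 * β ^ 2 * B) * β ^ 4
        + 9 * (α ^ 3 * β * A) * (α ^ 2 * β ^ 2 * B) * (α * β ^ 3 * C)
        - 2 * (α ^ 2 * β ^ 2 * B) ^ 3 - 27 * α ^ 4 * (α * β ^ 3 * C) ^ 2
        - 27 * (α ^ 3 * β * A) ^ 2 * β ^ 4) ^ 2 = (α * β) ^ 12 * normalizedDisc A B C := by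
    unfold normalizedDisc; ring
  have p2 : 0 < α ^ 2 * β ^ 2 := by positivity
  have p3 : 0 < α ^ 3 * β ^ 3 := by positivity
  have p12 : 0 < (α * β) ^ 12 := by positivity
  rw [binary_quartic_nonneg_iff hα hβ, hdisc, hsα, hsβ, hsαβ,
    show α * β ^ 3 * C * α ^ 2 + α ^ 3 * β * A * β ^ 2 = α ^ 3 * β ^ 3 * (A + C) by ring,
    show α ^ 3 * β * A * β ^ 2 + α * β ^ 3 * C * α ^ 2 = α ^ 3 * β ^ 3 * (A + C) by ring,
    show α ^ 3 * β * A * β ^ 2 - α * β ^ 3 * C * α ^ 2 = α ^ 3 * β ^ 3 * (A - C) by ring,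
    show α ^ 4 * (α ^ 2 * β ^ 2 * B) * β ^ 4 + 2 * α ^ 4 * β ^ 4 * (α ^ 2 * β ^ 2)
      = (α ^ 3 * β ^ 3) ^ 2 * (B + 2) by ring,
    show α ^ 4 * (α ^ 2 * β ^ 2 * B) * β ^ 4 - 2 * α ^ 4 * β ^ 4 * (α ^ 2 * β ^ 2)
      = (α ^ 3 * β ^ 3) ^ 2 * (B - 2) by ring, hsq, hsq,
    show α ^ 2 * β ^ 2 * B + 2 * (α ^ 2 * β ^ 2) = α ^ 2 * β ^ 2 * (B + 2) by ring,
    show -2 * (α ^ 2 * β ^ 2) = α ^ 2 * β ^ 2 * -2 by ring,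
    show 6 * (α ^ 2 * β ^ 2) = α ^ 2 * β ^ 2 * 6 by ring,
    show 4 * (α ^ 3 * β ^ 3 * √(B + 2)) = α ^ 3 * β ^ 3 * (4 * √(B + 2)) by ring,
    show -4 * (α ^ 3 * β ^ 3 * √(B - 2)) = α ^ 3 * β ^ 3 * (-4 * √(B - 2)) by ring,
    abs_mul, abs_of_pos p3, mul_le_mul_iff_right₀ p3, mul_le_mul_iff_right₀ p3,
    mul_le_mul_iff_right₀ p2, mul_le_mul_iff_right₀ p2, mul_lt_mul_iff_right₀ p2,
    mul_pos_iff_of_pos_left p3, mul_nonneg_iff_of_pos_left p2, mul_nonneg_iff_of_pos_left p12,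
    mul_nonneg_iff_of_pos_left (by positivity : 0 < α ^ 3 * β),
    mul_nonneg_iff_of_pos_left (by positivity : 0 < α * β ^ 3),
    mul_nonpos_iff_of_pos_left p12]
  rfl

theorem Couplings.potential_eq (c : Couplings) (x y : ℝ) :
    4 * c.lamS * c.Vtilde x y - (c.M x y) ^ 2 =
      c.l40 * x ^ 4 + c.l31 * x ^ 3 * y + c.l22 * x ^ 2 * y ^ 2 + c.l13 * x * y ^ 3
        + c.l04 * y ^ 4 := by
  simp only [Couplings.Vtilde, Couplings.M, Couplings.l40, Couplings.l31, Couplings.l22,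
    Couplings.l13, Couplings.l04]
  ring

theorem proposition3p5 (c : Couplings) (hrho : c.rho ∈ Set.Icc (0 : ℝ) 1)
    (h40 : c.l40 ≠ 0) (h04 : c.l04 ≠ 0) :
    (∀ h₁ h₂ : ℝ, 0 ≤ h₁ → 0 ≤ h₂ → 0 ≤ 4 * c.lamS * c.Vtilde h₁ h₂ - (c.M h₁ h₂) ^ 2) ↔
      0 < c.l40 ∧ 0 < c.l04 ∧
        ((c.Disc ≤ 0 ∧ 0 < c.l13 * √c.l40 + c.l31 * √c.l04) ∨
          (0 ≤ c.l13 ∧ 0 ≤ c.l31 ∧ 0 ≤ c.l22 + 2 * √(c.l40 * c.l04)) ∨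
          (0 ≤ c.Disc ∧
            |c.l31 * √c.l04 - c.l13 * √c.l40| ≤
              4 * √(c.l40 * c.l22 * c.l04 + 2 * c.l40 * c.l04 * √(c.l40 * c.l04)) ∧
            ((-2 * √(c.l40 * c.l04) ≤ c.l22 ∧ c.l22 ≤ 6 * √(c.l40 * c.l04)) ∨
              (6 * √(c.l40 * c.l04) < c.l22 ∧
                -4 * √(c.l40 * c.l22 * c.l04 - 2 * c.l40 * c.l04 * √(c.l40 * c.l04)) ≤
                  c.l31 * √c.l04 + c.l13 * √c.l40)))) := by
  simp only [Couplings.potential_eq]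
  have hiff := fun ha he => binary_quartic_nonneg_iff_criterion (a := c.l40) (b := c.l31)
    (c := c.l22) (d := c.l13) (e := c.l04) ha he
  constructor
  · intro h
    -- The values on the two axes are the end coefficients.
    have ha : 0 < c.l40 := lt_of_le_of_ne (by simpa using h 1 0 zero_le_one le_rfl) h40.symm
    have he : 0 < c.l04 := lt_of_le_of_ne (by simpa using h 0 1 le_rfl zero_le_one) h04.symm
    exact ⟨ha, he, (hiff ha he).1 h⟩
  · rintro ⟨ha, he, h⟩
    exact (hiff ha he).2 h
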